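/- Let $N\ge 3$ and let $G$ be the $N$-cycle with vertex set $\{0,\dots,N-1\}$. Let $W=(W_0,\dots,W_{N-1})\in\mathbb{R}^N$ be a potential and let $H_G=\mathcal{A}_G+W$ be the Schrödinger operator on $\mathbb{C}^N$, where $\mathcal{A}_G$ is the adjacency matrix of $G$ and $W$ acts by multiplication. Let $H_{\mathbb{Z}}$ be the lifted operator on $\ell^2(\mathbb{Z})$, $$(H_{\mathbb{Z}}f)(k)=f(k+1)+f(k-1)+W_kf(k),$$ where $W$ is extended $N$-periodically to $\mathbb{Z}$ by $W_{j+kN}:=W_j$. Let $\sigma(H_{\mathbb{Z}})\subset\mathbb{R}$ be its spectrum. Its connected components are called bands, and $\lambda$ is said to be in the bulk of the spectrum if it lies in the interior of a band. Let $\lambda\in\mathbb{R}$ be an eigenvalue of $H_G$ and let $\psi_\lambda:G\to\mathbb{C}$ be an eigenfunction, $H_G\psi_\lambda=\lambda\psi_\lambda$, with $\|\psi_\lambda\|_2=1$. 1. If $\lambda\notin\sigma(H_{\mathbb{Z}})$ and $\delta_\lambda=\operatorname{dist}(\lambda,\sigma(H_{\mathbb{Z}}))$, then $$\|\psi_\lambda\|_\infty^2\le\frac{16\,\delta_\lambda^{-2}}{N}.$$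 2. If $\lambda$ is in the bulk of the spectrum and the potential is moreover $m$-periodic, that is, $N=N'm$ for some integer $N'$ and $W_{j+km}=W_j$ on $G$, then $$\|\psi_\lambda\|_\infty^2\le\frac{C_{\lambda,m}}{N},$$ where the constant $C_{\lambda,m}$ depends only on $\lambda$ and $m$ (not on $N$, $W$ or $\psi_\lambda$). -/

import Mathlib

/-- The Hilbert space `ℓ²(ℤ; ℂ)`. -/
abbrev EllTwoZ : Type := lp (fun _ : ℤ => ℂ) 2

/-- The matrix of the Schrödinger operator `H_G = 𝒜_G + W` on the `N`-cycle `G` with vertex set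
`{0, …, N - 1}` (a genuine cycle for `3 ≤ N`), acting on complex functions. -/
noncomputable def cycleSchrodinger {N : ℕ} (W : Fin N → ℝ) : Matrix (Fin N) (Fin N) ℂ :=
  (SimpleGraph.cycleGraph N).adjMatrix ℂ + Matrix.diagonal (fun j => (W j : ℂ))

/-- `ψ` is an eigenfunction of the Schrödinger operator on the `N`-cycle, with eigenvalue `lam`
(in particular `ψ ≠ 0`). -/
def IsCycleEigenfunction {N : ℕ} (W : Fin N → ℝ) (lam : ℝ) (ψ : Fin N → ℂ) : Prop :=
  Module.End.HasEigenvector (Matrix.toLin' (cycleSchrodinger W)) (lam : ℂ) ψ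

/-- The `N`-periodic lift to `ℤ` of a potential on the `N`-cycle: `W_{j + k N} = W_j`. -/
def liftPotential {N : ℕ} [NeZero N] (W : Fin N → ℝ) (k : ℤ) : ℝ :=
  W (Fin.ofNat N (k % (N : ℤ)).toNat)

theorem liftPotential_add_mul {N : ℕ} [NeZero N] (W : Fin N → ℝ) (j : Fin N) (k : ℤ) :
    liftPotential W ((j : ℕ) + k * N) = W j := by
  unfold liftPotential
  congr 1
  have h : (((j : ℕ) : ℤ) + k * N) % (N : ℤ) = ((j : ℕ) : ℤ) := by
    rw [Int.add_mul_emod_self_right]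
    exact Int.emod_eq_of_lt (by positivity) (by exact_mod_cast j.isLt)
  rw [h]
  ext
  simp

theorem norm_liftPotential_le {N : ℕ} [NeZero N] (W : Fin N → ℝ) (k : ℤ) :
    ‖(liftPotential W k : ℂ)‖ ≤ ‖W‖ := by
  rw [Complex.norm_real]
  exact norm_le_pi_norm W _

theorem EllTwoZ.memℓp_shift (a : ℤ) (f : EllTwoZ) :
    Memℓp (fun k : ℤ => (f : ℤ → ℂ) (k + a)) 2 := by
  have h := (memℓp_gen_iff (p := 2) (by norm_num)).1 (lp.memℓp f)
  exact (memℓp_gen_iff (by norm_num)).2 ((Equiv.addRight a).summable_iff.2 h)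

/-- The shift `(S_a f)(k) = f (k + a)` on `ℓ²(ℤ)`. -/
noncomputable def shiftOp (a : ℤ) : EllTwoZ →L[ℂ] EllTwoZ :=
  LinearMap.mkContinuous
    { toFun := fun f => ⟨fun k => (f : ℤ → ℂ) (k + a), EllTwoZ.memℓp_shift a f⟩
      map_add' := fun _ _ => rfl
      map_smul' := fun _ _ => rfl } 1 (by
    intro f
    rw [one_mul]
    refine lp.norm_le_of_forall_sum_le (by norm_num) (norm_nonneg _) fun s => ?_
    have h := lp.sum_rpow_le_norm_rpow (p := 2) (by norm_num) f
      (s.map (Equiv.addRight a).toEmbedding)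
    rw [Finset.sum_map] at h
    exact h)

theorem EllTwoZ.norm_mul_le {N : ℕ} [NeZero N] (W : Fin N → ℝ) (z : ℤ → ℂ) (k : ℤ) :
    ‖(liftPotential W k : ℂ) * z k‖ ≤ ‖((‖W‖ : ℂ) • z) k‖ := by
  rw [Pi.smul_apply, smul_eq_mul, norm_mul, norm_mul, Complex.norm_real ‖W‖, norm_norm]
  exact mul_le_mul_of_nonneg_right (norm_liftPotential_le W k) (norm_nonneg _)

theorem EllTwoZ.memℓp_mul {N : ℕ} [NeZero N] (W : Fin N → ℝ) (f : EllTwoZ) :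
    Memℓp (fun k : ℤ => (liftPotential W k : ℂ) * (f : ℤ → ℂ) k) 2 := by
  have h := (memℓp_gen_iff (p := 2) (by norm_num)).1 ((lp.memℓp f).const_smul (‖W‖ : ℂ))
  refine (memℓp_gen_iff (by norm_num)).2 (Summable.of_nonneg_of_le (fun k => by positivity)
    (fun k => ?_) h)
  exact Real.rpow_le_rpow (norm_nonneg _) (EllTwoZ.norm_mul_le W f k) (by norm_num)

/-- Multiplication by the lifted potential on `ℓ²(ℤ)`. -/
noncomputable def potentialOp {N : ℕ} [NeZero N] (W : Fin N → ℝ) : EllTwoZ →L[ℂ] EllTwoZ :=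
  LinearMap.mkContinuous
    { toFun := fun f =>
        ⟨fun k => (liftPotential W k : ℂ) * (f : ℤ → ℂ) k, EllTwoZ.memℓp_mul W f⟩
      map_add' := fun f g => by ext k; exact mul_add _ _ _
      map_smul' := fun c f => by ext k; exact mul_left_comm _ _ _ } ‖W‖ (by
    intro f
    have e : ‖W‖ * ‖f‖ = ‖(‖W‖ : ℂ) • f‖ := by
      rw [norm_smul, Complex.norm_real, norm_norm]
    rw [e]
    refine lp.norm_le_of_forall_sum_le (by norm_num) (norm_nonneg _) fun s => ?_
    refine le_trans (Finset.sum_le_sum fun k _ => ?_)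
      (lp.sum_rpow_le_norm_rpow (p := 2) (by norm_num) ((‖W‖ : ℂ) • f) s)
    exact Real.rpow_le_rpow (norm_nonneg _) (EllTwoZ.norm_mul_le W f k) (by norm_num))

/-- The lifted Schrödinger operator `H_ℤ` on `ℓ²(ℤ)`. -/
noncomputable def lineSchrodinger {N : ℕ} [NeZero N] (W : Fin N → ℝ) : EllTwoZ →L[ℂ] EllTwoZ :=
  shiftOp 1 + shiftOp (-1) + potentialOp W

theorem lineSchrodinger_apply {N : ℕ} [NeZero N] (W : Fin N → ℝ) (f : EllTwoZ) (k : ℤ) :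
    (lineSchrodinger W f : ℤ → ℂ) k
      = (f : ℤ → ℂ) (k + 1) + (f : ℤ → ℂ) (k - 1)
        + (liftPotential W k : ℂ) * (f : ℤ → ℂ) k := rfl

/-- The spectrum `σ(H_ℤ)` as a set of real numbers (`H_ℤ` is self-adjoint). -/
def lineSpectrum {N : ℕ} [NeZero N] (W : Fin N → ℝ) : Set ℝ :=
  {x : ℝ | (x : ℂ) ∈ spectrum ℂ (lineSchrodinger W)}

/-- A band of `H_ℤ` is a maximal interval, i.e. a connected component, of `σ(H_ℤ)`. -/
def IsBand {N : ℕ} [NeZero N] (W : Fin N → ℝ) (I : Set ℝ) : Prop :=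
  ∃ x ∈ lineSpectrum W, I = connectedComponentIn (lineSpectrum W) x

/-- `lam` is in the bulk of the spectrum: it lies in the interior of a band. -/
def InBulk {N : ℕ} [NeZero N] (W : Fin N → ℝ) (lam : ℝ) : Prop :=
  ∃ I : Set ℝ, IsBand W I ∧ lam ∈ interior I

/-- The potential on the `N`-cycle is `m`-periodic: `m` divides `N`, and `W_{j + k m} = W_j`
whenever `j` and `j + k m` are both vertices. -/
def IsPeriodicPotential {N : ℕ} (m : ℕ) (W : Fin N → ℝ) : Prop :=
  m ∣ N ∧ ∀ (i j : Fin N) (k : ℕ), (i : ℕ) = j + k * m → W i = W j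

/-!
Both bounds use the periodic extension of an eigenfunction `ψ` of the cycle to `ℤ`, which solves the
eigenvalue equation of the lifted operator.

For the bound off the spectrum, multiply the extension by a tent of height `1` centred at a lift of
`j` and of slope `1 / N`. The product `u` lies in `ℓ²(ℤ)` and has norm at least `|ψ j|`, while
`H_ℤ u - lam u` contains only differences of the tent, so that its squared norm is at most `8 / N²`
(`exists_tent_eigenfunction`). Since `H_ℤ` is self-adjoint, `H_ℤ - lam` expands norms by at least the
distance `δ` from `lam` to the spectrum (`infDist_lineSpectrum`). Hence
`|ψ j|² ≤ 8 / (δ² N²)`. Tents of smaller slope give smaller bounds, which is the quantitative form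
of the Floquet inclusion of the eigenvalues of the cycle in the spectrum of `H_ℤ`.

For an `m`-periodic potential, translation by `m` is a unitary operator preserving the eigenspace of
`H_G` at `lam`, so the diagonal `j ↦ ‖P δ_j‖²` of the orthogonal projection `P` onto this eigenspace
is `m`-periodic. Its sum over the cycle is the dimension of the eigenspace, which is at most `2`
because the eigenvalue equation is a second-order recurrence. Every value of the diagonal is repeated
`N / m` times, so it is at most `2 m / N` (`norm_sq_starProjection_single_le`). This bounds
`|ψ j|² = |⟪P δ_j, ψ⟫|²`, and the constant `C = 2 m` serves for every `lam`.
-/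

/-! ### Distance to the spectrum of a self-adjoint operator -/

/-- For a self-adjoint operator `A` and a real point `x` off its spectrum, some real spectral point
`y` satisfies `|y - x| ‖f‖ ≤ ‖A f - x f‖` for all `f`: it is the reciprocal (shifted by `x`) of a
point of the spectrum of `(A - x)⁻¹` whose modulus is the norm of that resolvent. -/
theorem IsSelfAdjoint.exists_mem_spectrum_mul_norm_le {H : Type*} [NormedAddCommGroup H]
    [InnerProductSpace ℂ H] [CompleteSpace H] [Nontrivial H] {A : H →L[ℂ] H}
    (hA : IsSelfAdjoint A) {x : ℝ} (hx : (x : ℂ) ∉ spectrum ℂ A) :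
    ∃ y : ℝ, (y : ℂ) ∈ spectrum ℂ A ∧ ∀ f, |y - x| * ‖f‖ ≤ ‖A f - (x : ℂ) • f‖ := by
  have hB : IsSelfAdjoint (A - algebraMap ℂ (H →L[ℂ] H) (x : ℂ)) := by
    refine hA.sub ?_
    rw [IsSelfAdjoint, ← algebraMap_star_comm]
    simp
  have hu : IsUnit (A - algebraMap ℂ (H →L[ℂ] H) (x : ℂ)) := by
    rw [spectrum.notMem_iff] at hx
    simpa using hx.neg
  obtain ⟨B, hBe⟩ := hu
  have hR : IsSelfAdjoint (↑B⁻¹ : H →L[ℂ] H) := by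
    rw [← Ring.inverse_unit, hBe]
    exact hB.ringInverse
  obtain ⟨z, hz, hzn⟩ := spectrum.exists_nnnorm_eq_spectralRadius (↑B⁻¹ : H →L[ℂ] H)
  rw [hR.spectralRadius_eq_nnnorm] at hzn
  have hzn' : ‖z‖ = ‖(↑B⁻¹ : H →L[ℂ] H)‖ := by
    have h : ‖z‖₊ = ‖(↑B⁻¹ : H →L[ℂ] H)‖₊ := by exact_mod_cast hzn
    exact congrArg NNReal.toReal h
  have hz0 : z ≠ 0 := by
    rintro rfl
    exact (spectrum.zero_notMem_iff ℂ).2 (B⁻¹).isUnit hz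
  have hz1 : z⁻¹ ∈ spectrum ℂ (B : H →L[ℂ] H) := by
    have h := (spectrum.inv_mem_iff (r := Units.mk0 z hz0) (a := B⁻¹)).1 hz
    simpa using h
  have hz2 : z⁻¹ + x ∈ spectrum ℂ A := by
    rw [spectrum.add_mem_iff, neg_add_eq_sub, ← hBe]
    exact hz1
  have hre := hA.mem_spectrum_eq_re hz2
  refine ⟨(z⁻¹ + x).re, hre ▸ hz2, fun f => ?_⟩
  have habs : |(z⁻¹ + x).re - x| = ‖z‖⁻¹ := by
    rw [← norm_inv, ← Real.norm_eq_abs, ← Complex.norm_real]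
    push_cast
    rw [← hre, add_sub_cancel_right]
  have hf : ‖f‖ ≤ ‖z‖ * ‖A f - (x : ℂ) • f‖ := by
    have h1 : (↑B⁻¹ : H →L[ℂ] H) (A f - (x : ℂ) • f) = f := by
      have h2 : A f - (x : ℂ) • f = (B : H →L[ℂ] H) f := by
        rw [hBe]
        simp [Algebra.algebraMap_eq_smul_one]
      rw [h2, ← mul_apply_eq_comp, Units.inv_mul]
      rfl
    calc ‖f‖ = ‖(↑B⁻¹ : H →L[ℂ] H) (A f - (x : ℂ) • f)‖ := by rw [h1]
      _ ≤ _ := by rw [hzn']; exact ContinuousLinearMap.le_opNorm _ _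
  rw [habs, inv_mul_le_iff₀ (norm_pos_iff.2 hz0)]
  exact hf

/-! ### Self-adjointness of the lifted operator -/

theorem norm_shiftOp_apply_le (a : ℤ) (f : EllTwoZ) : ‖shiftOp a f‖ ≤ ‖f‖ := by
  refine ((shiftOp a).le_opNorm f).trans ?_
  exact mul_le_of_le_one_left (norm_nonneg _)
    (LinearMap.mkContinuous_norm_le _ zero_le_one _)

theorem inner_shiftOp_left (a : ℤ) (f g : EllTwoZ) :
    inner ℂ (shiftOp a f) g = inner ℂ f (shiftOp (-a) g) := by
  rw [lp.inner_eq_tsum, lp.inner_eq_tsum, ← (Equiv.addRight a).tsum_eq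
    fun k => inner ℂ ((f : ℤ → ℂ) k) ((shiftOp (-a) g : ℤ → ℂ) k)]
  refine tsum_congr fun k => ?_
  change inner ℂ ((f : ℤ → ℂ) (k + a)) ((g : ℤ → ℂ) k)
    = inner ℂ ((f : ℤ → ℂ) (k + a)) ((g : ℤ → ℂ) (k + a + -a))
  rw [add_neg_cancel_right]

theorem inner_potentialOp_left {N : ℕ} [NeZero N] (W : Fin N → ℝ) (f g : EllTwoZ) :
    inner ℂ (potentialOp W f) g = inner ℂ f (potentialOp W g) := by
  rw [lp.inner_eq_tsum, lp.inner_eq_tsum]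
  refine tsum_congr fun k => ?_
  change inner ℂ ((liftPotential W k : ℂ) • (f : ℤ → ℂ) k) ((g : ℤ → ℂ) k)
    = inner ℂ ((f : ℤ → ℂ) k) ((liftPotential W k : ℂ) • (g : ℤ → ℂ) k)
  rw [inner_smul_left, inner_smul_right, Complex.conj_ofReal]

theorem isSelfAdjoint_lineSchrodinger {N : ℕ} [NeZero N] (W : Fin N → ℝ) :
    IsSelfAdjoint (lineSchrodinger W) := by
  rw [ContinuousLinearMap.isSelfAdjoint_iff_isSymmetric]
  intro f g
  change inner ℂ (shiftOp 1 f + shiftOp (-1) f + potentialOp W f) g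
    = inner ℂ f (shiftOp 1 g + shiftOp (-1) g + potentialOp W g)
  rw [inner_add_left, inner_add_left, inner_add_right, inner_add_right, inner_shiftOp_left,
    inner_shiftOp_left, inner_potentialOp_left, neg_neg]
  ring

theorem isClosed_lineSpectrum {N : ℕ} [NeZero N] (W : Fin N → ℝ) : IsClosed (lineSpectrum W) :=
  (spectrum.isClosed (lineSchrodinger W)).preimage Complex.continuous_ofReal

instance : Nontrivial EllTwoZ :=
  ⟨⟨lp.single 2 0 1, 0, fun h => by
    have := congrArg (fun f : EllTwoZ => (f : ℤ → ℂ) 0) h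
    simp at this⟩⟩

/-- Off the spectrum the distance to the spectrum is positive, and `H_ℤ - lam` expands norms by at
least that distance. -/
theorem infDist_lineSpectrum {N : ℕ} [NeZero N] (W : Fin N → ℝ) {lam : ℝ}
    (hlam : lam ∉ lineSpectrum W) :
    0 < Metric.infDist lam (lineSpectrum W) ∧ ∀ f : EllTwoZ,
      Metric.infDist lam (lineSpectrum W) * ‖f‖ ≤ ‖lineSchrodinger W f - (lam : ℂ) • f‖ := by
  obtain ⟨y, hy, hyf⟩ :=
    (isSelfAdjoint_lineSchrodinger W).exists_mem_spectrum_mul_norm_le (x := lam) hlam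
  have hy' : y ∈ lineSpectrum W := hy
  refine ⟨((isClosed_lineSpectrum W).notMem_iff_infDist_pos ⟨y, hy'⟩).1 hlam, fun f => ?_⟩
  refine le_trans ?_ (hyf f)
  gcongr
  rw [← Real.dist_eq, dist_comm]
  exact Metric.infDist_le_dist_of_mem hy'

/-! ### Periodic extension of functions on the cycle -/

/-- The covering map `ℤ → {0, …, N - 1}`, `k ↦ k mod N`, for which `liftPotential W` is
`W ∘ cycleProj N`. -/
def cycleProj (N : ℕ) [NeZero N] (k : ℤ) : Fin N :=
  Fin.ofNat N (k % (N : ℤ)).toNat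

theorem val_cycleProj (N : ℕ) [NeZero N] (k : ℤ) : ((cycleProj N k : ℕ) : ℤ) = k % (N : ℤ) := by
  have hN : (0 : ℤ) < N := by exact_mod_cast Nat.pos_of_neZero N
  have h0 := Int.emod_nonneg k hN.ne'
  have h1 := Int.emod_lt_of_pos k hN
  have : (k % (N : ℤ)).toNat < N := by omega
  simp only [cycleProj, Fin.ofNat, Nat.mod_eq_of_lt this]
  omega

theorem cycleProj_eq_iff {N : ℕ} [NeZero N] {k l : ℤ} :
    cycleProj N k = cycleProj N l ↔ k ≡ l [ZMOD N] := by
  rw [Fin.ext_iff, Int.ModEq, ← val_cycleProj, ← val_cycleProj]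
  exact Nat.cast_inj.symm

theorem cycleProj_natCast_val {N : ℕ} [NeZero N] (j : Fin N) : cycleProj N (j : ℕ) = j := by
  have h := val_cycleProj N ((j : ℕ) : ℤ)
  have hj := j.isLt
  rw [Int.emod_eq_of_lt (by positivity) (by exact_mod_cast hj)] at h
  exact Fin.ext (by exact_mod_cast h)

theorem cycleProj_add {N : ℕ} [NeZero N] (k l : ℤ) :
    cycleProj N (k + l) = cycleProj N k + cycleProj N l := by
  apply Fin.ext
  have h : (((cycleProj N k + cycleProj N l : Fin N) : ℕ) : ℤ) = (k + l) % (N : ℤ) := by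
    rw [Fin.val_add]
    push_cast
    rw [val_cycleProj, val_cycleProj, ← Int.add_emod]
  rw [← val_cycleProj] at h
  exact_mod_cast h.symm

/-- Any `N` consecutive integers enumerate the cycle once. -/
theorem sum_Ico_cycleProj {N : ℕ} [NeZero N] (F : Fin N → ℝ) (a : ℤ) :
    ∑ k ∈ Finset.Ico a (a + N), F (cycleProj N k) = ∑ j, F j := by
  have hinj : Set.InjOn (cycleProj N) (Finset.Ico a (a + N) : Finset ℤ) := by
    intro k hk l hl h
    rw [Finset.mem_coe, Finset.mem_Ico] at hk hl
    rw [cycleProj_eq_iff, Int.modEq_iff_dvd] at h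
    have := Int.eq_zero_of_abs_lt_dvd h (by rw [abs_lt]; omega)
    omega
  rw [← Finset.sum_image (f := F) hinj]
  congr 1
  rw [← Finset.card_eq_iff_eq_univ, Finset.card_image_of_injOn hinj]
  simp

theorem cycleSchrodinger_mulVec {N : ℕ} [NeZero N] (hN : 3 ≤ N) (W : Fin N → ℝ) (ψ : Fin N → ℂ)
    (j : Fin N) : (cycleSchrodinger W).mulVec ψ j
      = ψ (j + cycleProj N 1) + ψ (j + cycleProj N (-1)) + W j * ψ j := by
  obtain ⟨n, rfl⟩ : ∃ n, N = n + 3 := ⟨N - 3, by omega⟩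
  have h1 : cycleProj (n + 3) 1 = 1 := by
    have h := cycleProj_natCast_val (1 : Fin (n + 3))
    simpa using h
  have h2 : cycleProj (n + 3) (-1) = -1 := by
    rw [eq_neg_iff_add_eq_zero, ← h1, ← cycleProj_add]
    have h := cycleProj_natCast_val (0 : Fin (n + 3))
    simpa using h
  have hne : j - 1 ≠ j + 1 := by
    intro h
    have h3 := (SimpleGraph.cycleGraph_degree_three_le (n := n) (v := j))
    rw [← SimpleGraph.card_neighborFinset_eq_degree, SimpleGraph.cycleGraph_neighborFinset, h]
      at h3
    simp at h3
  rw [cycleSchrodinger, Matrix.add_mulVec, Pi.add_apply, SimpleGraph.adjMatrix_mulVec_apply,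
    SimpleGraph.cycleGraph_neighborFinset, Finset.sum_pair hne, Matrix.mulVec_diagonal, h1, h2,
    add_comm (ψ (j - 1)), sub_eq_add_neg]

/-- The periodic extension of an eigenfunction solves the eigenvalue equation on `ℤ`. -/
theorem cycleProj_recurrence {N : ℕ} [NeZero N] (hN : 3 ≤ N) {W : Fin N → ℝ} {lam : ℝ}
    {ψ : Fin N → ℂ} (h : (cycleSchrodinger W).mulVec ψ = (lam : ℂ) • ψ) (k : ℤ) :
    ψ (cycleProj N (k + 1)) + ψ (cycleProj N (k - 1))
      + liftPotential W k * ψ (cycleProj N k) = lam * ψ (cycleProj N k) := by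
  have := congrFun h (cycleProj N k)
  rw [cycleSchrodinger_mulVec hN, ← cycleProj_add, ← cycleProj_add] at this
  exact this

theorem IsCycleEigenfunction.mulVec_eq {N : ℕ} {W : Fin N → ℝ} {lam : ℝ} {ψ : Fin N → ℂ}
    (h : IsCycleEigenfunction W lam ψ) : (cycleSchrodinger W).mulVec ψ = (lam : ℂ) • ψ := by
  have := Module.End.HasEigenvector.apply_eq_smul h
  rwa [Matrix.toLin'_apply] at this

/-! ### Tent cutoffs -/

theorem EllTwoZ.memℓp_of_finset {f : ℤ → ℂ} (s : Finset ℤ) (hf : ∀ k ∉ s, f k = 0) :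
    Memℓp f 2 :=
  (memℓp_gen_iff (by norm_num)).2
    (summable_of_ne_finset_zero (s := s) fun k hk => by simp [hf k hk])

theorem EllTwoZ.norm_sq_eq_sum (f : EllTwoZ) (s : Finset ℤ) (hf : ∀ k ∉ s, (f : ℤ → ℂ) k = 0) :
    ‖f‖ ^ 2 = ∑ k ∈ s, ‖(f : ℤ → ℂ) k‖ ^ 2 := by
  have h := lp.norm_rpow_eq_tsum (p := 2) (by norm_num) f
  rw [tsum_eq_sum (s := s) fun k hk => by simp [hf k hk]] at h
  simpa using h

/-- Multiplying the periodic extension of a normalized `ψ` by a weight of size at most `c`, living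
on two periods, gives an element of `ℓ²(ℤ)` of norm at most `c √2`. -/
theorem norm_sq_le_of_weight {N : ℕ} [NeZero N] {ψ : Fin N → ℂ} (hψ : ∑ j, ‖ψ j‖ ^ 2 = 1)
    {χ : ℤ → ℝ} {c : ℝ} (a : ℤ) (hχ : ∀ k, |χ k| ≤ c)
    (hχ0 : ∀ k ∉ Finset.Ico a (a + 2 * N), χ k = 0) (f : EllTwoZ)
    (hf : ∀ k, (f : ℤ → ℂ) k = χ k * ψ (cycleProj N k)) : ‖f‖ ^ 2 ≤ 2 * c ^ 2 := by
  rw [EllTwoZ.norm_sq_eq_sum f (Finset.Ico a (a + 2 * N)) fun k hk => by simp [hf, hχ0 k hk]]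
  calc ∑ k ∈ Finset.Ico a (a + 2 * N), ‖(f : ℤ → ℂ) k‖ ^ 2
      ≤ ∑ k ∈ Finset.Ico a (a + 2 * N), c ^ 2 * ‖ψ (cycleProj N k)‖ ^ 2 := by
        refine Finset.sum_le_sum fun k _ => ?_
        rw [hf, norm_mul, Complex.norm_real, mul_pow, Real.norm_eq_abs]
        gcongr
        exact hχ k
    _ = c ^ 2 * (∑ k ∈ Finset.Ico a (a + N), ‖ψ (cycleProj N k)‖ ^ 2
          + ∑ k ∈ Finset.Ico (a + N) (a + N + N), ‖ψ (cycleProj N k)‖ ^ 2) := by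
        rw [← Finset.mul_sum, ← Finset.sum_union
          (Finset.Ico_disjoint_Ico_consecutive _ _ _), Finset.Ico_union_Ico_eq_Ico (by omega)
          (by omega)]
        congr 3
        ring
    _ = 2 * c ^ 2 := by
        rw [sum_Ico_cycleProj (fun j => ‖ψ j‖ ^ 2), sum_Ico_cycleProj (fun j => ‖ψ j‖ ^ 2), hψ]
        ring

/-- The tent of height `1` and slope `1 / N` centred at `a`. -/
noncomputable def tent (N : ℕ) (a k : ℤ) : ℝ :=
  max 0 (1 - |(k : ℝ) - a| / N)

theorem tent_self (N : ℕ) (a : ℤ) : tent N a a = 1 := by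
  simp [tent]

theorem tent_eq_zero {N : ℕ} [NeZero N] {a k : ℤ} (h : k ≤ a - N ∨ a + N ≤ k) :
    tent N a k = 0 := by
  have hN : (0 : ℝ) < N := by exact_mod_cast Nat.pos_of_neZero N
  refine max_eq_left ?_
  rw [sub_nonpos, one_le_div hN, le_abs]
  rcases h with h | h
  · right
    have : (k : ℝ) ≤ a - N := by exact_mod_cast h
    linarith
  · left
    have : (a : ℝ) + N ≤ k := by exact_mod_cast h
    linarith

theorem abs_tent_sub_tent_le {N : ℕ} (a k l : ℤ) :
    |tent N a k - tent N a l| ≤ |(k : ℝ) - l| / N := by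
  refine (abs_max_sub_max_le_max _ _ _ _).trans (max_le ?_ ?_)
  · rw [sub_self, abs_zero]
    positivity
  have e : (1 - |(k : ℝ) - a| / N) - (1 - |(l : ℝ) - a| / N)
      = (|(l : ℝ) - a| - |(k : ℝ) - a|) / N := by ring
  rw [e, abs_div, Nat.abs_cast, abs_sub_comm (k : ℝ) l]
  refine div_le_div_of_nonneg_right ?_ (Nat.cast_nonneg N)
  simpa using abs_abs_sub_abs_le ((l : ℝ) - a) (k - a)

/-- Multiplying a normalized cycle eigenfunction, extended periodically, by a tent of slope `1 / N`
centred at a lift of `j` gives a function on `ℤ` of norm at least `|ψ j|` on which `H_ℤ - lam` is of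
size at most `2 √2 / N`: by the eigenvalue equation, only differences of the tent survive. -/
theorem exists_tent_eigenfunction {N : ℕ} [NeZero N] (hN : 3 ≤ N) {W : Fin N → ℝ} {lam : ℝ}
    {ψ : Fin N → ℂ} (h : (cycleSchrodinger W).mulVec ψ = (lam : ℂ) • ψ)
    (hψ : ∑ j, ‖ψ j‖ ^ 2 = 1) (j : Fin N) :
    ∃ u : EllTwoZ, ‖ψ j‖ ≤ ‖u‖ ∧
      ‖lineSchrodinger W u - (lam : ℂ) • u‖ ^ 2 ≤ 8 * (1 / (N : ℝ)) ^ 2 := by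
  set a : ℤ := ((j : ℕ) : ℤ) with ha
  have hout : ∀ k : ℤ, ∀ c : ℤ, k ∉ Finset.Ico c (c + 2 * N) → k < c ∨ c + 2 * N ≤ k := by
    intro k c hk
    rw [Finset.mem_Ico] at hk
    omega
  -- the tent, and its backward and forward differences, as weights supported on two periods
  have hφ0 : ∀ k ∉ Finset.Ico (a - N) (a - N + 2 * N), tent N a k = 0 := fun k hk =>
    tent_eq_zero (by have := hout k _ hk; omega)
  have hb0 : ∀ k ∉ Finset.Ico (a - N + 1) (a - N + 1 + 2 * N),
      tent N a k - tent N a (k - 1) = 0 := fun k hk => by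
    have := hout k _ hk
    rw [tent_eq_zero (k := k) (by omega), tent_eq_zero (k := k - 1) (by omega), sub_zero]
  have hf0 : ∀ k ∉ Finset.Ico (a - N) (a - N + 2 * N),
      tent N a k - tent N a (k + 1) = 0 := fun k hk => by
    have := hout k _ hk
    rw [tent_eq_zero (k := k) (by omega), tent_eq_zero (k := k + 1) (by omega), sub_zero]
  let u : EllTwoZ := ⟨fun k => (tent N a k : ℂ) * ψ (cycleProj N k),
    EllTwoZ.memℓp_of_finset (Finset.Ico (a - N) (a - N + 2 * N)) fun k hk => by
      rw [hφ0 k hk]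
      simp⟩
  let gb : EllTwoZ := ⟨fun k => ((tent N a k - tent N a (k - 1) : ℝ) : ℂ) * ψ (cycleProj N k),
    EllTwoZ.memℓp_of_finset (Finset.Ico (a - N + 1) (a - N + 1 + 2 * N)) fun k hk => by
      rw [hb0 k hk]
      simp⟩
  let gf : EllTwoZ := ⟨fun k => ((tent N a k - tent N a (k + 1) : ℝ) : ℂ) * ψ (cycleProj N k),
    EllTwoZ.memℓp_of_finset (Finset.Ico (a - N) (a - N + 2 * N)) fun k hk => by
      rw [hf0 k hk]
      simp⟩
  have hgb : ‖gb‖ ^ 2 ≤ 2 * (1 / (N : ℝ)) ^ 2 :=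
    norm_sq_le_of_weight hψ _ (fun k => by simpa using abs_tent_sub_tent_le a k (k - 1)) hb0 gb
      fun _ => rfl
  have hgf : ‖gf‖ ^ 2 ≤ 2 * (1 / (N : ℝ)) ^ 2 :=
    norm_sq_le_of_weight hψ _ (fun k => by simpa using abs_tent_sub_tent_le a k (k + 1)) hf0 gf
      fun _ => rfl
  have hHu : lineSchrodinger W u - (lam : ℂ) • u = shiftOp 1 gb + shiftOp (-1) gf := by
    ext k
    have hrec := cycleProj_recurrence hN h k
    change (tent N a (k + 1) : ℂ) * ψ (cycleProj N (k + 1))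
        + (tent N a (k - 1) : ℂ) * ψ (cycleProj N (k - 1))
        + (liftPotential W k : ℂ) * ((tent N a k : ℂ) * ψ (cycleProj N k))
        - (lam : ℂ) * ((tent N a k : ℂ) * ψ (cycleProj N k))
      = ((tent N a (k + 1) - tent N a (k + 1 - 1) : ℝ) : ℂ) * ψ (cycleProj N (k + 1))
        + ((tent N a (k - 1) - tent N a (k - 1 + 1) : ℝ) : ℂ) * ψ (cycleProj N (k - 1))
    rw [add_sub_cancel_right, sub_add_cancel]
    push_cast
    linear_combination (tent N a k : ℂ) * hrec
  refine ⟨u, ?_, ?_⟩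
  · have h1 := lp.norm_apply_le_norm (by norm_num) u a
    have h2 : (u : ℤ → ℂ) a = ψ j := by
      change (tent N a a : ℂ) * ψ (cycleProj N a) = ψ j
      rw [tent_self, ha, cycleProj_natCast_val]
      simp
    rwa [h2] at h1
  · rw [hHu]
    have h1 : ‖shiftOp 1 gb + shiftOp (-1) gf‖ ≤ ‖gb‖ + ‖gf‖ :=
      (norm_add_le _ _).trans (add_le_add (norm_shiftOp_apply_le _ _) (norm_shiftOp_apply_le _ _))
    calc ‖shiftOp 1 gb + shiftOp (-1) gf‖ ^ 2 ≤ (‖gb‖ + ‖gf‖) ^ 2 := by gcongr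
      _ ≤ 2 * (‖gb‖ ^ 2 + ‖gf‖ ^ 2) := add_sq_le
      _ ≤ _ := by linarith

theorem sum_norm_sq_eq_one {N : ℕ} {ψ : Fin N → ℂ} (h : ‖WithLp.toLp 2 ψ‖ = 1) :
    ∑ j, ‖ψ j‖ ^ 2 = 1 := by
  have := EuclideanSpace.norm_sq_eq (WithLp.toLp 2 ψ)
  rw [h] at this
  simpa using this.symm

/-- A pointwise bound on the squares bounds the square of the supremum norm. -/
theorem norm_sq_le_of_forall {N : ℕ} [NeZero N] {ψ : Fin N → ℂ} {c : ℝ}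
    (h : ∀ j, ‖ψ j‖ ^ 2 ≤ c) : ‖ψ‖ ^ 2 ≤ c := by
  have hc : 0 ≤ c := (sq_nonneg _).trans (h 0)
  rw [← Real.le_sqrt (norm_nonneg _) hc, pi_norm_le_iff_of_nonneg (Real.sqrt_nonneg _)]
  exact fun j => Real.le_sqrt_of_sq_le (h j)

/-- The bound off the spectrum; the tent argument gives it with `8 / (δ² N²)`. -/
theorem norm_sq_le_of_notMem_lineSpectrum {N : ℕ} [NeZero N] (hN : 3 ≤ N) {W : Fin N → ℝ}
    {lam : ℝ} {ψ : Fin N → ℂ} (h : IsCycleEigenfunction W lam ψ) (hψ : ‖WithLp.toLp 2 ψ‖ = 1)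
    (hlam : lam ∉ lineSpectrum W) :
    ‖ψ‖ ^ 2 ≤ 16 * (Metric.infDist lam (lineSpectrum W))⁻¹ ^ 2 / N := by
  obtain ⟨hδ, hexp⟩ := infDist_lineSpectrum W hlam
  set δ := Metric.infDist lam (lineSpectrum W)
  have hN1 : (1 : ℝ) ≤ N := by exact_mod_cast (by omega : 1 ≤ N)
  refine norm_sq_le_of_forall fun j => ?_
  obtain ⟨u, hu, hHu⟩ := exists_tent_eigenfunction hN h.mulVec_eq (sum_norm_sq_eq_one hψ) j
  have h1 : (δ * ‖ψ j‖) ^ 2 ≤ 8 * (1 / (N : ℝ)) ^ 2 := by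
    refine le_trans ?_ hHu
    gcongr
    exact (mul_le_mul_of_nonneg_left hu hδ.le).trans (hexp u)
  have h2 : (1 / (N : ℝ)) ^ 2 ≤ 1 / N :=
    pow_le_of_le_one (by positivity) (by rw [div_le_one (by linarith)]; exact hN1) (by norm_num)
  have h3 : (0 : ℝ) ≤ 1 / N := by positivity
  calc ‖ψ j‖ ^ 2 = δ⁻¹ ^ 2 * (δ * ‖ψ j‖) ^ 2 := by field_simp
    _ ≤ δ⁻¹ ^ 2 * (16 * (1 / N)) := by
        gcongr
        linarith
    _ = _ := by ring

/-! ### Orthogonal projections and isometries -/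

theorem OrthonormalBasis.sum_norm_sq_starProjection {ι H : Type*} [Fintype ι]
    [NormedAddCommGroup H] [InnerProductSpace ℂ H] (e : OrthonormalBasis ι ℂ H)
    (E : Submodule ℂ H) [FiniteDimensional ℂ E] :
    ∑ i, ‖E.starProjection (e i)‖ ^ 2 = Module.finrank ℂ E := by
  let b := stdOrthonormalBasis ℂ E
  have h (x : H) : ‖E.starProjection x‖ ^ 2 = ∑ k, ‖inner ℂ (b k : H) x‖ ^ 2 := by
    rw [Submodule.starProjection_apply, ← Submodule.coe_norm, ← b.sum_sq_norm_inner_right]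
    simp_rw [Submodule.inner_orthogonalProjectionOnto_eq_of_mem_left]
  simp_rw [h]
  rw [Finset.sum_comm]
  simp_rw [e.sum_sq_norm_inner_left, ← Submodule.coe_norm, b.norm_eq_one]
  simp

theorem Submodule.norm_starProjection_map {H : Type*} [NormedAddCommGroup H]
    [InnerProductSpace ℂ H] (U : H ≃ₗᵢ[ℂ] H) {E F : Submodule ℂ H} [E.HasOrthogonalProjection]
    [F.HasOrthogonalProjection] (hF : E.map (U.toLinearEquiv : H →ₗ[ℂ] H) = F) (x : H) :
    ‖F.starProjection (U x)‖ = ‖E.starProjection x‖ := by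
  subst hF
  rw [Submodule.starProjection_map_apply, U.symm_apply_apply, U.norm_map]

/-! ### Eigenspaces of a periodic potential -/

/-- The eigenspace of `H_G` at `lam`, as a subspace of the Hilbert space `ℂ^N`. -/
noncomputable def cycleEigenspace {N : ℕ} (W : Fin N → ℝ) (lam : ℝ) :
    Submodule ℂ (EuclideanSpace ℂ (Fin N)) :=
  (Module.End.eigenspace (Matrix.toLin' (cycleSchrodinger W)) (lam : ℂ)).comap
    (WithLp.linearEquiv 2 ℂ (Fin N → ℂ) : EuclideanSpace ℂ (Fin N) →ₗ[ℂ] Fin N → ℂ)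

theorem mem_cycleEigenspace {N : ℕ} {W : Fin N → ℝ} {lam : ℝ} {f : EuclideanSpace ℂ (Fin N)} :
    f ∈ cycleEigenspace W lam
      ↔ (cycleSchrodinger W).mulVec (WithLp.ofLp f) = (lam : ℂ) • WithLp.ofLp f := by
  rw [cycleEigenspace, Submodule.mem_comap, Module.End.mem_eigenspace_iff, Matrix.toLin'_apply]
  rfl

/-- A second-order recurrence is determined by two consecutive values. -/
theorem finrank_cycleEigenspace_le {N : ℕ} [NeZero N] (hN : 3 ≤ N) (W : Fin N → ℝ) (lam : ℝ) :
    Module.finrank ℂ (cycleEigenspace W lam) ≤ 2 := by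
  let L : cycleEigenspace W lam →ₗ[ℂ] ℂ × ℂ :=
    { toFun := fun f => (f.1 (cycleProj N 0), f.1 (cycleProj N 1))
      map_add' := fun _ _ => rfl
      map_smul' := fun _ _ => rfl }
  have hL : Function.Injective L := by
    rw [injective_iff_map_eq_zero]
    rintro ⟨f, hf⟩ h0
    have hrec := cycleProj_recurrence hN (mem_cycleEigenspace.1 hf)
    have hz : ∀ n : ℕ, f (cycleProj N n) = 0 ∧ f (cycleProj N (n + 1)) = 0 := by
      intro n
      induction n with
      | zero => exact ⟨congrArg Prod.fst h0, congrArg Prod.snd h0⟩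
      | succ n ih =>
        have h := hrec (n + 1)
        rw [add_sub_cancel_right, ih.1, ih.2] at h
        push_cast
        exact ⟨ih.2, by simpa using h⟩
    apply Subtype.ext
    ext j
    have := (hz j).1
    rwa [cycleProj_natCast_val] at this
  have := LinearMap.finrank_le_finrank_of_injective hL
  simpa using this

/-- Translation by `p` on functions on the cycle, as a unitary operator: it moves a unit mass at `j`
to `j + p`. -/
noncomputable def cycleTranslation {N : ℕ} [NeZero N] (p : Fin N) :
    EuclideanSpace ℂ (Fin N) ≃ₗᵢ[ℂ] EuclideanSpace ℂ (Fin N) :=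
  LinearIsometryEquiv.piLpCongrLeft 2 ℂ ℂ (Equiv.addRight p)

theorem map_cycleTranslation_cycleEigenspace {N : ℕ} [NeZero N] (hN : 3 ≤ N) {W : Fin N → ℝ}
    (lam : ℝ) {p : Fin N} (hW : ∀ j, W (j + p) = W j) :
    (cycleEigenspace W lam).map ((cycleTranslation p).toLinearEquiv :
      EuclideanSpace ℂ (Fin N) →ₗ[ℂ] EuclideanSpace ℂ (Fin N)) = cycleEigenspace W lam := by
  refine Submodule.eq_of_le_of_finrank_eq ?_ (LinearEquiv.finrank_map_eq _ _)
  rintro _ ⟨f, hf, rfl⟩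
  rw [SetLike.mem_coe, mem_cycleEigenspace] at hf
  rw [mem_cycleEigenspace]
  ext j
  have h := congrFun hf (j + -p)
  have hWj : W j = W (j + -p) := by rw [← hW (j + -p), neg_add_cancel_right]
  rw [cycleSchrodinger_mulVec hN, add_right_comm j (-p) (cycleProj N 1),
    add_right_comm j (-p) (cycleProj N (-1))] at h
  rw [cycleSchrodinger_mulVec hN, hWj]
  exact h

theorem IsPeriodicPotential.apply_add {N m : ℕ} [NeZero N] {W : Fin N → ℝ}
    (h : IsPeriodicPotential m W) (j : Fin N) : W (j + cycleProj N m) = W j := by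
  obtain ⟨⟨N', hN'⟩, hW⟩ := h
  have hN := Nat.pos_of_neZero N
  have hN'0 : 0 < N' := Nat.pos_of_ne_zero (by rintro rfl; omega)
  obtain ⟨q, rfl⟩ : ∃ q, N' = q + 1 := ⟨N' - 1, by omega⟩
  have hNm : N = q * m + m := by rw [hN']; ring
  have hj := j.isLt
  have hval : ((j + cycleProj N m : Fin N) : ℕ) = (j + m) % N := by
    have h := val_cycleProj N ((j : ℕ) + m)
    rw [cycleProj_add, cycleProj_natCast_val] at h
    exact_mod_cast h
  -- passing from `j` to `j + m` either stays inside `{0, …, N - 1}` or wraps around once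
  rcases lt_or_ge ((j : ℕ) + m) N with hlt | hge
  · rw [Nat.mod_eq_of_lt hlt] at hval
    exact hW _ _ 1 (by rw [hval, one_mul])
  · rw [Nat.mod_eq_sub_mod hge, Nat.mod_eq_of_lt (by omega)] at hval
    exact (hW _ _ q (by omega)).symm

/-- If the nonnegative function `F` on the cycle is `m`-periodic, with `N = N' m`, then every value
of `F` occurs at least `N'` times in its sum. -/
theorem mul_le_sum_of_periodic {N m N' : ℕ} [NeZero N] (hNm : N = m * N') {F : Fin N → ℝ}
    (hF0 : ∀ j, 0 ≤ F j) (hF : ∀ j, F (j + cycleProj N m) = F j) (j : Fin N) :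
    N' * F j ≤ ∑ i, F i := by
  have hm : (m : ℤ) ≠ 0 := by
    rintro h
    have := NeZero.ne N
    simp_all
  have hper : ∀ k : ℕ, F (cycleProj N ((j : ℕ) + k * m)) = F j := by
    intro k
    induction k with
    | zero => simp [cycleProj_natCast_val]
    | succ k ih =>
      rw [← ih, ← hF (cycleProj N ((j : ℕ) + k * m)), ← cycleProj_add]
      congr 2
      push_cast
      ring
  have hinj : Set.InjOn (fun k : ℕ => cycleProj N ((j : ℕ) + k * m)) (Finset.range N') := by
    intro k hk l hl h
    rw [Finset.mem_coe, Finset.mem_range] at hk hl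
    have h := cycleProj_eq_iff.1 h
    rw [Int.modEq_iff_dvd, add_sub_add_left_eq_sub, ← sub_mul, hNm, Nat.cast_mul, mul_comm,
      mul_dvd_mul_iff_right hm] at h
    have := Int.eq_zero_of_abs_lt_dvd h (by rw [abs_lt]; omega)
    omega
  calc N' * F j = ∑ k ∈ Finset.range N', F (cycleProj N ((j : ℕ) + k * m)) := by
        simp [hper]
    _ = ∑ i ∈ (Finset.range N').image fun k : ℕ => cycleProj N ((j : ℕ) + k * m), F i :=
        (Finset.sum_image hinj).symm
    _ ≤ ∑ i, F i := Finset.sum_le_univ_sum_of_nonneg hF0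

/-- The diagonal `‖P δ_j‖²` of the spectral projection of an `m`-periodic `H_G` is itself
`m`-periodic, and its sum is the multiplicity of the eigenvalue, hence at most `2`. -/
theorem norm_sq_starProjection_single_le {N m : ℕ} [NeZero N] (hN : 3 ≤ N) {W : Fin N → ℝ}
    (hW : IsPeriodicPotential m W) (lam : ℝ) (j : Fin N) :
    ‖(cycleEigenspace W lam).starProjection (EuclideanSpace.single j 1)‖ ^ 2 ≤ 2 * m / N := by
  obtain ⟨N', hN'⟩ := hW.1
  have h := mul_le_sum_of_periodic hN'
    (F := fun j => ‖(cycleEigenspace W lam).starProjection (EuclideanSpace.single j 1)‖ ^ 2)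
    (fun _ => sq_nonneg _) (fun i => ?_) j
  · have hsum := (EuclideanSpace.basisFun (Fin N) ℂ).sum_norm_sq_starProjection
      (cycleEigenspace W lam)
    simp_rw [EuclideanSpace.basisFun_apply] at hsum
    have h2 : (Module.finrank ℂ (cycleEigenspace W lam) : ℝ) ≤ 2 := by
      exact_mod_cast finrank_cycleEigenspace_le hN W lam
    have hNR : (N : ℝ) = m * N' := by exact_mod_cast hN'
    rw [le_div_iff₀ (by exact_mod_cast Nat.pos_of_neZero N)]
    calc _ = m * (N' * ‖(cycleEigenspace W lam).starProjection
            (EuclideanSpace.single j 1)‖ ^ 2) := by rw [hNR]; ring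
      _ ≤ m * 2 := by gcongr; exact h.trans (hsum.trans_le h2)
      _ = _ := mul_comm _ _
  · have := Submodule.norm_starProjection_map (cycleTranslation (cycleProj N m))
      (map_cycleTranslation_cycleEigenspace hN lam hW.apply_add)
      (EuclideanSpace.single i (1 : ℂ))
    rw [cycleTranslation, EuclideanSpace.piLpCongrLeft_single, Equiv.coe_addRight] at this
    simp only [this]

theorem norm_sq_le_of_isPeriodicPotential {N m : ℕ} [NeZero N] (hN : 3 ≤ N) {W : Fin N → ℝ}
    {lam : ℝ} {ψ : Fin N → ℂ} (hW : IsPeriodicPotential m W) (h : IsCycleEigenfunction W lam ψ)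
    (hψ : ‖WithLp.toLp 2 ψ‖ = 1) : ‖ψ‖ ^ 2 ≤ 2 * m / N := by
  refine norm_sq_le_of_forall fun j => le_trans ?_ (norm_sq_starProjection_single_le hN hW lam j)
  gcongr
  have hmem : WithLp.toLp 2 ψ ∈ cycleEigenspace W lam := mem_cycleEigenspace.2 h.mulVec_eq
  -- `ψ j = ⟪δ_j, ψ⟫ = ⟪P δ_j, ψ⟫`
  have hj : ψ j = inner ℂ ((cycleEigenspace W lam).starProjection (EuclideanSpace.single j 1))
      (WithLp.toLp 2 ψ) := by
    rw [Submodule.inner_starProjection_left_eq_right,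
      Submodule.starProjection_eq_self_iff.2 hmem, EuclideanSpace.inner_single_left]
    simp
  calc ‖ψ j‖ ≤ ‖(cycleEigenspace W lam).starProjection (EuclideanSpace.single j 1)‖
        * ‖WithLp.toLp 2 ψ‖ := hj ▸ norm_inner_le_norm _ _
    _ = _ := by rw [hψ, mul_one]

/-! ### The two bounds on normalized eigenfunctions -/

theorem theorem1p1 :
    (∀ (N : ℕ) [NeZero N], 3 ≤ N →
      ∀ (W : Fin N → ℝ) (lam : ℝ) (ψ : Fin N → ℂ),
        IsCycleEigenfunction W lam ψ → ‖WithLp.toLp 2 ψ‖ = 1 →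
        lam ∉ lineSpectrum W →
        ‖ψ‖ ^ 2 ≤ 16 * (Metric.infDist lam (lineSpectrum W))⁻¹ ^ 2 / N) ∧
    (∀ (lam : ℝ) (m : ℕ), ∃ C : ℝ,
      ∀ (N : ℕ) [NeZero N], 3 ≤ N →
      ∀ (W : Fin N → ℝ) (ψ : Fin N → ℂ),
        IsPeriodicPotential m W →
        IsCycleEigenfunction W lam ψ → ‖WithLp.toLp 2 ψ‖ = 1 →
        InBulk W lam →
        ‖ψ‖ ^ 2 ≤ C / N) :=
  ⟨fun _ _ hN _ _ _ h hψ hlam => norm_sq_le_of_notMem_lineSpectrum hN h hψ hlam,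
    fun _ m => ⟨2 * m, fun _ _ hN _ _ hW h hψ _ => norm_sq_le_of_isPeriodicPotential hN hW h hψ⟩⟩
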